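/- A \emph{chain graph} is a bipartite graph that does not contain an induced matching of size $2$. For a finite bipartite graph $G=(V,E)$, the \emph{minimum chain cover number} $\operatorname{ch}(G)$ is the smallest number of chain graphs on the vertex set $V$ such that the union of their edge sets is $E$ (so $\operatorname{ch}(G)=0$ if $E=\emptyset$). There is a polynomial-time approximation algorithm with factor $$\kappa(n)=2\left\lceil\frac{n\sqrt{\log\log n}}{\sqrt{\log n}}\right\rceil$$ for the minimum chain cover number of $n$-vertex bipartite graphs. That is, there are an algorithm and a polynomial $T$ such that, for every $n$ and every bipartite graph $G$ with vertex set $\{0,\dots,n-1\}$, given by $n$ and its adjacency matrix, the algorithm halts after at most $T(n)$ steps and, if $n\ge 3$, outputs a natural number $a$ with $$\operatorname{ch}(G)\le a\le \kappa(n)\cdot\operatorname{ch}(G).$$ Here $\log$ is the natural logarithm (for $n\ge 3$ the factor with binary logarithms is at least as large, so the statement holds for it as well). The algorithm is a program for a random access machine with registers and arrays of natural numbers, indirect addressing, and unit-cost addition, truncated subtraction and zero tests; polynomial time on this machine is the same as on Turing machines. -/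

import Mathlib

/-! ### Chain graphs and the minimum chain cover number -/

/-- A chain graph: a bipartite graph without an induced matching of size `2`. -/
def SimpleGraph.IsChainGraph {V : Type*} (H : SimpleGraph V) : Prop :=
  H.IsBipartite ∧ ¬ ∃ M : H.Subgraph, M.IsInduced ∧ M.IsMatching ∧ M.edgeSet.ncard = 2

/-- `C` is a cover of `G` by `k` chain graphs on the vertex set of `G`: the union of their
edge sets is the edge set of `G`. -/
def SimpleGraph.IsChainCover {V : Type*} (G : SimpleGraph V) {k : ℕ}
    (C : Fin k → SimpleGraph V) : Prop :=
  (∀ i, (C i).IsChainGraph) ∧ ⋃ i, (C i).edgeSet = G.edgeSet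

/-- The minimum chain cover number `ch(G)`. -/
noncomputable def SimpleGraph.chainCoverNumber {V : Type*} (G : SimpleGraph V) : ℕ :=
  sInf {k : ℕ | ∃ C : Fin k → SimpleGraph V, G.IsChainCover C}

/-- The approximation factor `2⌈n √(log log n) / √(log n)⌉`, with natural logarithms. For `3 ≤ n`
this is at most the same expression with binary logarithms. -/
noncomputable def chainCoverFactor (n : ℕ) : ℕ :=
  2 * ⌈(n : ℝ) * √(Real.log (Real.log n)) / √(Real.log n)⌉₊

/-! ### Random access machines

Programs over finitely many scalar registers and finitely many infinite arrays of natural numbers,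
with indirect addressing and structured control flow. The arithmetic is addition and truncated
subtraction (no multiplication), and every elementary operation costs one step, so that polynomial
time is the same as on Turing machines. -/

namespace RAM

/-- The content of the registers and of the arrays: `s.var x` is the register `x` and `s.arr a k` is
the cell `k` of the array `a`. -/
structure State where
  var : ℕ → ℕ
  arr : ℕ → ℕ → ℕ

/-- Expressions; `read a e` is the cell of the array `a` whose index is the value of `e`. -/
inductive Expr where
  | const (c : ℕ)
  | var (x : ℕ)
  | read (a : ℕ) (e : Expr)
  | add (e₁ e₂ : Expr)
  | sub (e₁ e₂ : Expr)

/-- The value of an expression. -/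
def Expr.eval (s : State) : Expr → ℕ
  | const c => c
  | var x => s.var x
  | read a e => s.arr a (e.eval s)
  | add e₁ e₂ => e₁.eval s + e₂.eval s
  | sub e₁ e₂ => e₁.eval s - e₂.eval s

/-- The number of steps it takes to evaluate an expression. -/
def Expr.cost : Expr → ℕ
  | const _ => 1
  | var _ => 1
  | read _ e => e.cost + 1
  | add e₁ e₂ => e₁.cost + e₂.cost + 1
  | sub e₁ e₂ => e₁.cost + e₂.cost + 1

/-- Programs. -/
inductive Prog where
  | skip
  /-- store the value of `e` in the register `x` -/
  | assign (x : ℕ) (e : Expr)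
  /-- store the value of `e` in the cell of the array `a` whose index is the value of `i` -/
  | write (a : ℕ) (i e : Expr)
  | seq (p q : Prog)
  /-- run `p` if the value of `e` is not `0`, and `q` otherwise -/
  | branch (e : Expr) (p q : Prog)
  /-- run `p` again and again as long as the value of `e` is not `0` -/
  | loop (e : Expr) (p : Prog)

/-- The state after storing `v` in the register `x`. -/
def State.setVar (s : State) (x v : ℕ) : State :=
  { s with var := Function.update s.var x v }

/-- The state after storing `v` in the cell `k` of the array `a`. -/
def State.setArr (s : State) (a k v : ℕ) : State :=
  { s with arr := Function.update s.arr a (Function.update (s.arr a) k v) }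

/-- `Exec p s t s'`: started in the state `s`, the program `p` halts after exactly `t` steps in the
state `s'`. -/
inductive Exec : Prog → State → ℕ → State → Prop
  | skip (s : State) : Exec .skip s 1 s
  | assign (x : ℕ) (e : Expr) (s : State) :
      Exec (.assign x e) s (e.cost + 1) (s.setVar x (e.eval s))
  | write (a : ℕ) (i e : Expr) (s : State) :
      Exec (.write a i e) s (i.cost + e.cost + 1) (s.setArr a (i.eval s) (e.eval s))
  | seq {p q : Prog} {s s' s'' : State} {t t' : ℕ} :
      Exec p s t s' → Exec q s' t' s'' → Exec (.seq p q) s (t + t') s''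
  | branch_true {e : Expr} {p q : Prog} {s s' : State} {t : ℕ} :
      e.eval s ≠ 0 → Exec p s t s' → Exec (.branch e p q) s (e.cost + 1 + t) s'
  | branch_false {e : Expr} {p q : Prog} {s s' : State} {t : ℕ} :
      e.eval s = 0 → Exec q s t s' → Exec (.branch e p q) s (e.cost + 1 + t) s'
  | loop_done {e : Expr} {p : Prog} {s : State} :
      e.eval s = 0 → Exec (.loop e p) s (e.cost + 1) s
  | loop_step {e : Expr} {p : Prog} {s s' s'' : State} {t t' : ℕ} :
      e.eval s ≠ 0 → Exec p s t s' → Exec (.loop e p) s' t' s'' →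
      Exec (.loop e p) s (e.cost + 1 + t + t') s''

/-- Programs are deterministic: the final state and the number of steps are determined by the
initial state. -/
theorem Exec.deterministic {p : Prog} {s s₁ s₂ : State} {t₁ t₂ : ℕ}
    (h₁ : Exec p s t₁ s₁) (h₂ : Exec p s t₂ s₂) : t₁ = t₂ ∧ s₁ = s₂ := by
  induction h₁ generalizing t₂ s₂ with
  | skip s => cases h₂; exact ⟨rfl, rfl⟩
  | assign x e s => cases h₂; exact ⟨rfl, rfl⟩
  | write a i e s => cases h₂; exact ⟨rfl, rfl⟩
  | seq _ _ ih ih' =>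
    cases h₂ with
    | seq k k' =>
      obtain ⟨rfl, rfl⟩ := ih k
      obtain ⟨rfl, rfl⟩ := ih' k'
      exact ⟨rfl, rfl⟩
  | branch_true he _ ih =>
    cases h₂ with
    | branch_true _ k => obtain ⟨rfl, rfl⟩ := ih k; exact ⟨rfl, rfl⟩
    | branch_false he' _ => exact absurd he' he
  | branch_false he _ ih =>
    cases h₂ with
    | branch_true he' _ => exact absurd he he'
    | branch_false _ k => obtain ⟨rfl, rfl⟩ := ih k; exact ⟨rfl, rfl⟩
  | loop_done he =>
    cases h₂ with
    | loop_done _ => exact ⟨rfl, rfl⟩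
    | loop_step he' _ _ => exact absurd he he'
  | loop_step he _ _ ih ih' =>
    cases h₂ with
    | loop_done he' => exact absurd he' he
    | loop_step _ k k' =>
      obtain ⟨rfl, rfl⟩ := ih k
      obtain ⟨rfl, rfl⟩ := ih' k'
      exact ⟨rfl, rfl⟩

open Classical in
/-- The initial state for the input `G`, a graph with the vertices `0, …, n - 1`: the register `0`
holds `n`, the cells `i * n + j` (`i, j < n`) of the array `0` hold the adjacency matrix of `G`, and
everything else is `0`. -/
noncomputable def initState {n : ℕ} (G : SimpleGraph (Fin n)) : State where
  var x := if x = 0 then n else 0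
  arr a k := if a = 0 ∧ ∃ i j : Fin n, k = (i : ℕ) * n + j ∧ G.Adj i j then 1 else 0

/-- The number that a program leaves behind as its output: the content of the register `0`. -/
def State.output (s : State) : ℕ := s.var 0

end RAM

/-! Cut the vertices into blocks of `k = blockSize n` consecutive numbers. A ranking of a block
gives a chain graph: keep the edge `uv` with `u` in the block if every block vertex ranked no higher
than `u` is adjacent to `v`. Lowering the rank of `u` only enlarges its set of kept neighbours, so
these sets are nested. Rankings that cover all edges at each block therefore give a chain cover of
`G` (`exists_isChainCover_sum`). Conversely, a chain graph orders the block vertices of either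
colour by their neighbourhoods, so a cover by `h` chain graphs gives `2 * h` rankings of any block
(`coverable_two_mul`). The least number of rankings of a block is thus at most `2 ch(G)`, and
summing it over the blocks loses twice the number of nonempty blocks, which
`lt_ceil_of_mul_blockSize_lt` bounds.

The block size is a compromise. Since `k` rankings always suffice, they are encoded by `k * k`
digits to the base `k`, and exhaustive search is polynomial because `k ^ (k * k)` is
(`blockSize_pow_le`). On the other hand `k` is at least `√(log n / log log n)`
(`log_le_blockSize_sq_mul`).

The program is never written out: `PolyTime` is closed under arithmetic, bounded iteration, and
hence bounded sums and quantifiers, so `polyTime_chainCoverEstimate` follows the definition of the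
estimate. -/

namespace RAM

/-! ### Functions computable in polynomial time -/

/-- An input of the algorithm: a graph with the vertices `0, …, n - 1`. -/
abbrev Inst : Type := Σ n : ℕ, SimpleGraph (Fin n)

/-- A context: an input together with the values of finitely many variables. -/
class Ctx (α : Type) where
  inp : α → Inst
  vars : α → List ℕ
  getLast?_vars : ∀ a, (vars a).getLast? = some (inp a).1

instance : Ctx Inst where
  inp a := a
  vars a := [a.1]
  getLast?_vars _ := rfl

instance {α : Type} [Ctx α] : Ctx (α × ℕ) where
  inp a := Ctx.inp a.1
  vars a := a.2 :: Ctx.vars a.1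
  getLast?_vars a := by rw [List.getLast?_cons, Ctx.getLast?_vars]; rfl

variable {α : Type} [Ctx α]

/-- The size of a context: the sum of its variables, the number of vertices among them. -/
def size (a : α) : ℕ := (Ctx.vars a).sum

@[simp] theorem size_pair (a : α) (x : ℕ) : size (a, x) = x + size a := rfl

/-- The state `s` holds the context `a`, with its variables in the registers `ρ`. -/
def Holds (ρ : List ℕ) (s : State) (a : α) : Prop :=
  s.arr = (initState (Ctx.inp a).2).arr ∧ ρ.map s.var = Ctx.vars a

/-- From a state that holds a context `a` in the registers `ρ`, the program `p` computes `f a` in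
polynomial time and stores it in the register `m`, without changing lower registers or arrays. -/
def Computes (p : Prog) (m c : ℕ) (ρ : List ℕ) (f : α → ℕ) : Prop :=
  ∀ s a, Holds ρ s a → ∃ t s', Exec p s t s' ∧ t ≤ (size a + 2) ^ c ∧ s'.arr = s.arr ∧
    (∀ x < m, s'.var x = s.var x) ∧ s'.var m = f a

/-- Growth bounded by a polynomial in the size of the context. -/
def PolyBounded (f : α → ℕ) : Prop := ∃ c, ∀ a, f a ≤ (size a + 2) ^ c

/-- Computability in polynomial time. -/
def PolyTime (f : α → ℕ) : Prop :=
  PolyBounded f ∧ ∀ m ρ, (∀ r ∈ ρ, r < m) → ∃ p c, Computes p m c ρ f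

theorem PolyBounded.mono {f g : α → ℕ} (hg : PolyBounded g) (h : ∀ a, f a ≤ g a) :
    PolyBounded f := by
  obtain ⟨c, hc⟩ := hg
  exact ⟨c, fun a => (h a).trans (hc a)⟩

theorem polyBounded_const (k : ℕ) : PolyBounded fun _ : α => k :=
  ⟨k, fun a => (Nat.lt_two_pow_self).le.trans (Nat.pow_le_pow_left (by omega) _)⟩

theorem polyBounded_size : PolyBounded (size : α → ℕ) := ⟨1, fun a => by simp⟩

theorem PolyBounded.mul {f g : α → ℕ} (hf : PolyBounded f) (hg : PolyBounded g) :
    PolyBounded fun a => f a * g a := by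
  obtain ⟨c, hc⟩ := hf
  obtain ⟨d, hd⟩ := hg
  exact ⟨c + d, fun a => by rw [pow_add]; exact Nat.mul_le_mul (hc a) (hd a)⟩

theorem PolyBounded.add {f g : α → ℕ} (hf : PolyBounded f) (hg : PolyBounded g) :
    PolyBounded fun a => f a + g a := by
  obtain ⟨c, hc⟩ := hf
  obtain ⟨d, hd⟩ := hg
  refine ⟨c + d + 1, fun a => ?_⟩
  have h1 : (size a + 2) ^ c ≤ (size a + 2) ^ (c + d) := Nat.pow_le_pow_right (by omega) (by omega)
  have h2 : (size a + 2) ^ d ≤ (size a + 2) ^ (c + d) := Nat.pow_le_pow_right (by omega) (by omega)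
  rw [pow_succ]
  nlinarith [hc a, hd a]

theorem PolyBounded.pow {f : α → ℕ} (hf : PolyBounded f) (k : ℕ) :
    PolyBounded fun a => f a ^ k := by
  obtain ⟨c, hc⟩ := hf
  exact ⟨c * k, fun a => by rw [pow_mul]; exact Nat.pow_le_pow_left (hc a) k⟩

theorem Holds.congr {ρ : List ℕ} {s s' : State} {a : α} {m : ℕ} (h : Holds ρ s a)
    (hρ : ∀ r ∈ ρ, r < m) (harr : s'.arr = s.arr) (hvar : ∀ x < m, s'.var x = s.var x) :
    Holds ρ s' a :=
  ⟨harr.trans h.1, by rw [← h.2]; exact List.map_congr_left fun r hr => hvar r (hρ r hr)⟩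

theorem setVar_var (s : State) (x v y : ℕ) :
    (s.setVar x v).var y = if y = x then v else s.var y := by
  simp [State.setVar, Function.update_apply]

@[simp] theorem setVar_arr (s : State) (x v : ℕ) : (s.setVar x v).arr = s.arr := rfl

theorem PolyTime.of_eq {f g : α → ℕ} (hf : PolyTime f) (h : ∀ a, f a = g a) : PolyTime g :=
  (funext h : f = g) ▸ hf

/-- A computation whose running time is bounded by an arbitrary polynomially bounded function. -/
theorem exists_computes {f T : α → ℕ} {m : ℕ} {ρ : List ℕ} (p : Prog) (hT : PolyBounded T)
    (h : ∀ s a, Holds ρ s a → ∃ t s', Exec p s t s' ∧ t ≤ T a ∧ s'.arr = s.arr ∧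
      (∀ x < m, s'.var x = s.var x) ∧ s'.var m = f a) : ∃ p c, Computes p m c ρ f := by
  obtain ⟨c, hc⟩ := hT
  refine ⟨p, c, fun s a hs => ?_⟩
  obtain ⟨t, s', h1, h2, h3⟩ := h s a hs
  exact ⟨t, s', h1, h2.trans (hc a), h3⟩

/-- Functions that are the value of an expression. -/
theorem PolyTime.of_expr {f : α → ℕ} (hb : PolyBounded f)
    (h : ∀ ρ : List ℕ, ∃ e : Expr, ∀ s a, Holds ρ s a → e.eval s = f a) : PolyTime f := by
  refine ⟨hb, fun m ρ _ => ?_⟩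
  obtain ⟨e, he⟩ := h ρ
  refine exists_computes (.assign m e) (polyBounded_const (e.cost + 1)) fun s a hs =>
    ⟨_, _, .assign m e s, le_rfl, rfl, fun x hx => ?_, ?_⟩
  · rw [setVar_var, if_neg hx.ne]
  · rw [setVar_var, if_pos rfl, he s a hs]

theorem PolyTime.const (k : ℕ) : PolyTime fun _ : α => k :=
  .of_expr (polyBounded_const k) fun _ => ⟨.const k, fun _ _ _ => rfl⟩

theorem order_le_size (a : α) : (Ctx.inp a).1 ≤ size a :=
  List.single_le_sum (by simp) _ (List.mem_of_getLast? (Ctx.getLast?_vars a))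

/-- New variables are prepended to the context, so `n` always sits in the last register of `ρ`; the
default `0` is never reached. -/
theorem PolyTime.order : PolyTime fun a : α => (Ctx.inp a).1 := by
  refine .of_expr (polyBounded_size.mono order_le_size) fun ρ =>
    ⟨.var (ρ.getLast?.getD 0), fun s a h => ?_⟩
  have h1 := Ctx.getLast?_vars a
  rw [← h.2, List.getLast?_map, Option.map_eq_some_iff] at h1
  obtain ⟨r, hr, h2⟩ := h1
  rw [hr, Expr.eval, ← h2, Option.getD_some]

theorem PolyTime.snd : PolyTime fun a : α × ℕ => a.2 := by
  refine .of_expr (polyBounded_size.mono fun a => Nat.le_add_right _ _) fun ρ => ?_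
  match ρ with
  | [] => exact ⟨.const 0, fun s a h => by simp [Holds, Ctx.vars] at h⟩
  | r :: _ => exact ⟨.var r, fun s a h => (List.cons.inj h.2).1⟩

/-- The same program works: it ignores the register of the extra variable, and the time bound only
grows. -/
theorem PolyTime.weaken {f : α → ℕ} (hf : PolyTime f) : PolyTime fun a : α × ℕ => f a.1 := by
  refine ⟨?_, fun m ρ hρ => ?_⟩
  · obtain ⟨c, hc⟩ := hf.1
    exact ⟨c, fun a => (hc a.1).trans
      (Nat.pow_le_pow_left (Nat.add_le_add_right (Nat.le_add_left _ _) 2) c)⟩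
  · match ρ with
    | [] => exact ⟨.skip, 0, fun s a h => by simp [Holds, Ctx.vars] at h⟩
    | r :: ρ =>
      obtain ⟨p, c, hp⟩ := hf.2 m ρ fun r hr => hρ r (List.mem_cons_of_mem _ hr)
      refine ⟨p, c, fun s a h => ?_⟩
      obtain ⟨t, s', h1, h2, h3⟩ := hp s a.1 ⟨h.1, (List.cons.inj h.2).2⟩
      exact ⟨t, s', h1, h2.trans
        (Nat.pow_le_pow_left (Nat.add_le_add_right (Nat.le_add_left _ _) 2) c), h3⟩

/-- Binary operations given by an expression in two registers. -/
theorem PolyTime.binary {f g h : α → ℕ} (hf : PolyTime f) (hg : PolyTime g) (hb : PolyBounded h)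
    (e : ℕ → Expr) (c₀ : ℕ) (hc₀ : ∀ m, (e m).cost ≤ c₀)
    (he : ∀ m s a, s.arr = (initState (Ctx.inp a).2).arr → s.var m = f a → s.var (m + 1) = g a →
      (e m).eval s = h a) : PolyTime h := by
  refine ⟨hb, fun m ρ hρ => ?_⟩
  obtain ⟨p, c, hp⟩ := hf.2 m ρ hρ
  -- Working from `m + 1` upwards, `q` preserves the value of `f` in the register `m`.
  obtain ⟨q, d, hq⟩ := hg.2 (m + 1) ρ fun r hr => (hρ r hr).trans (Nat.lt_succ_self m)
  refine exists_computes (.seq p (.seq q (.assign m (e m))))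
    (((polyBounded_size.add (polyBounded_const 2)).pow c).add
      (((polyBounded_size.add (polyBounded_const 2)).pow d).add (polyBounded_const (c₀ + 1))))
    fun s a hs => ?_
  obtain ⟨t₁, s₁, k₁, l₁, a₁, v₁, r₁⟩ := hp s a hs
  have hs₁ := hs.congr hρ a₁ v₁
  obtain ⟨t₂, s₂, k₂, l₂, a₂, v₂, r₂⟩ := hq s₁ a hs₁
  refine ⟨_, _, .seq k₁ (.seq k₂ (.assign m (e m) s₂)), ?_, ?_, fun x hx => ?_, ?_⟩
  · have := hc₀ m
    omega
  · rw [setVar_arr, a₂, a₁]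
  · rw [setVar_var, if_neg hx.ne, v₂ x (by omega), v₁ x hx]
  · rw [setVar_var, if_pos rfl, he m s₂ a (by rw [a₂, a₁, hs.1]) (by rw [v₂ m (by omega), r₁]) r₂]

theorem PolyTime.add {f g : α → ℕ} (hf : PolyTime f) (hg : PolyTime g) :
    PolyTime fun a => f a + g a :=
  hf.binary hg (hf.1.add hg.1) (fun m => .add (.var m) (.var (m + 1))) 3 (fun _ => le_rfl)
    fun m s a _ h1 h2 => by simp only [Expr.eval, h1, h2]

theorem PolyTime.sub {f g : α → ℕ} (hf : PolyTime f) (hg : PolyTime g) :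
    PolyTime fun a => f a - g a :=
  hf.binary hg (hf.1.mono fun _ => Nat.sub_le _ _) (fun m => .sub (.var m) (.var (m + 1))) 3
    (fun _ => le_rfl) fun m s a _ h1 h2 => by simp only [Expr.eval, h1, h2]

theorem PolyTime.read {f : α → ℕ} (hf : PolyTime f) :
    PolyTime fun a => (initState (Ctx.inp a).2).arr 0 (f a) :=
  hf.binary hf ((polyBounded_const 1).mono fun a => by simp only [initState]; split <;> simp)
    (fun m => .read 0 (.var m)) 2 (fun _ => le_rfl)
    fun m s a h h1 _ => by simp only [Expr.eval, h1, h]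

/-- Iteration, as long as the intermediate results are polynomially bounded. -/
theorem PolyTime.iterate {e f : α → ℕ} {g : α → ℕ → ℕ → ℕ} (he : PolyTime e) (hf : PolyTime f)
    (hg : PolyTime fun a : (α × ℕ) × ℕ => g a.1.1 a.1.2 a.2) {b : α → ℕ} (hb : PolyBounded b)
    (hle : ∀ a, ∀ i ≤ e a, Nat.rec (f a) (g a) i ≤ b a) :
    PolyTime fun a => (Nat.rec (f a) (g a) (e a) : ℕ) := by
  refine ⟨hb.mono fun a => hle a _ le_rfl, fun m ρ hρ => ?_⟩
  obtain ⟨p, c, hp⟩ := he.2 m ρ hρ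
  obtain ⟨q, d, hq⟩ := hf.2 (m + 1) ρ fun r hr => (hρ r hr).trans (by omega)
  obtain ⟨w, l, hw⟩ := hg.2 (m + 3) ((m + 1) :: (m + 2) :: ρ) (by
    intro r hr
    simp only [List.mem_cons] at hr
    rcases hr with rfl | rfl | hr
    · omega
    · omega
    · exact (hρ r hr).trans (by omega))
  -- Register `m` holds the number of rounds, `m + 1` the accumulator, `m + 2` the counter, and `m +
  -- 3` receives the next value.
  let guard : Expr := .sub (.var m) (.var (m + 2))
  let body : Prog := .seq w (.seq (.assign (m + 1) (.var (m + 3)))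
    (.assign (m + 2) (.add (.var (m + 2)) (.const 1))))
  -- The accumulator is an input of `w`, so its bound `b a` enters the running time; `10` pays for
  -- the guard and the two assignments.
  let step : α → ℕ := fun a => (b a + e a + size a + 2) ^ l + 10
  -- Induction on the number `i` of rounds still to run.
  have hloop : ∀ a i s, i ≤ e a → Holds ρ s a → s.var m = e a → s.var (m + 2) = e a - i →
      s.var (m + 1) = Nat.rec (f a) (g a) (e a - i) → ∃ t s', Exec (.loop guard body) s t s' ∧
        t ≤ i * step a + 4 ∧ s'.arr = s.arr ∧ (∀ x < m, s'.var x = s.var x) ∧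
        s'.var (m + 1) = Nat.rec (f a) (g a) (e a) := by
    intro a i
    induction i with
    | zero =>
      intro s _ hs h1 h2 h3
      exact ⟨_, s, .loop_done (by simp [guard, Expr.eval, h1, h2]), by simp [guard, Expr.cost], rfl,
        fun _ _ => rfl, h3⟩
    | succ i ih =>
      intro s hi hs h1 h2 h3
      obtain ⟨t₁, s₁, k₁, l₁, a₁, v₁, r₁⟩ := hw s
        ((a, e a - (i + 1)), Nat.rec (f a) (g a) (e a - (i + 1))) ⟨hs.1, by
          simp only [List.map_cons, Ctx.vars, h2, h3, hs.2]⟩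
      let s₂ := (s₁.setVar (m + 1) (s₁.var (m + 3)))
      let s₃ := s₂.setVar (m + 2) (s₂.var (m + 2) + 1)
      have hv : ∀ x < m + 1, s₃.var x = s.var x := fun x hx => by
        simp only [s₃, s₂, setVar_var]
        rw [if_neg (by omega), if_neg (by omega), v₁ x (by omega)]
      have hstep : e a - i = e a - (i + 1) + 1 := by omega
      obtain ⟨t₄, s₄, k₄, l₄, a₄, v₄, r₄⟩ := ih s₃ (by omega)
        (hs.congr hρ a₁ fun x hx => hv x (by omega)) (by rw [hv m (by omega), h1])
        (by
          simp only [s₃, s₂, setVar_var, if_true]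
          rw [if_neg (by omega), v₁ _ (by omega), h2, hstep])
        (by
          simp only [s₃, s₂, setVar_var, if_true]
          rw [if_neg (by omega), r₁, hstep])
      refine ⟨_, s₄, .loop_step (by simp only [guard, Expr.eval, h1, h2]; omega)
        (.seq k₁ (.seq (.assign _ _ _) (.assign _ _ _))) k₄, ?_, a₄.trans a₁,
        fun x hx => (v₄ x hx).trans (hv x (by omega)), r₄⟩
      have h5 : t₁ ≤ (b a + e a + size a + 2) ^ l := by
        refine l₁.trans (Nat.pow_le_pow_left ?_ l)
        have := hle a (e a - (i + 1)) (by omega)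
        simp only [size_pair]
        omega
      have h6 : (i + 1) * step a = i * step a + ((b a + e a + size a + 2) ^ l + 10) := by
        simp only [step]
        ring
      simp only [guard, Expr.cost]
      omega
  have hN := polyBounded_size.add (polyBounded_const (α := α) 2)
  refine exists_computes (.seq p (.seq q (.seq (.assign (m + 2) (.const 0))
    (.seq (.loop guard body) (.assign m (.var (m + 1)))))))
    (T := fun a => (size a + 2) ^ c + (size a + 2) ^ d + e a * step a + 8) ?_ ?_
  · exact ((((hN.pow c).add (hN.pow d)).add (he.1.mul
      (((((hb.add he.1).add polyBounded_size).add (polyBounded_const 2)).pow l).add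
        (polyBounded_const 10)))).add (polyBounded_const 8))
  · intro s a hs
    obtain ⟨t₁, s₁, k₁, l₁, a₁, v₁, r₁⟩ := hp s a hs
    have hs₁ := hs.congr hρ a₁ v₁
    obtain ⟨t₂, s₂, k₂, l₂, a₂, v₂, r₂⟩ := hq s₁ a hs₁
    have hv : ∀ x < m + 2, (s₂.setVar (m + 2) 0).var x = s₂.var x := fun x hx => by
      rw [setVar_var, if_neg hx.ne]
    obtain ⟨t₃, s₃, k₃, l₃, a₃, v₃, r₃⟩ := hloop a (e a) (s₂.setVar (m + 2) 0) le_rfl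
      (hs₁.congr hρ a₂ fun x hx => by rw [hv x (by omega), v₂ x (by omega)])
      (by rw [hv m (by omega), v₂ m (by omega), r₁])
      (by rw [setVar_var, if_pos rfl, Nat.sub_self])
      ((hv _ (Nat.lt_succ_self (m + 1))).trans (r₂.trans (by rw [Nat.sub_self]; rfl)))
    refine ⟨_, _, .seq k₁ (.seq k₂ (.seq (.assign _ _ _) (.seq k₃ (.assign _ _ _)))), ?_, ?_,
      fun x hx => ?_, ?_⟩
    · simp only [Expr.cost]
      omega
    · rw [setVar_arr, a₃, setVar_arr, a₂, a₁]
    · rw [setVar_var, if_neg hx.ne, v₃ x hx, hv x (by omega), v₂ x (by omega), v₁ x hx]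
    · rw [setVar_var, if_pos rfl, ← r₃, Expr.eval]

theorem PolyTime.sum {e : α → ℕ} {g : α → ℕ → ℕ} (he : PolyTime e)
    (hg : PolyTime fun a : α × ℕ => g a.1 a.2) :
    PolyTime fun a => ∑ i ∈ Finset.range (e a), g a i := by
  obtain ⟨c, hc⟩ := hg.1
  have hrec : ∀ a i, (Nat.rec 0 (fun i x => x + g a i) i : ℕ) = ∑ j ∈ Finset.range i, g a j := by
    intro a i
    induction i with
    | zero => rfl
    | succ i ih => rw [Finset.sum_range_succ, ← ih]
  refine (PolyTime.iterate (g := fun a i x => x + g a i) he (.const 0)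
    (PolyTime.add .snd hg.weaken)
    (b := fun a => e a * (e a + size a + 2) ^ c)
    (he.1.mul (((he.1.add polyBounded_size).add (polyBounded_const 2)).pow c)) ?_).of_eq
    fun a => hrec a (e a)
  intro a i hi
  rw [hrec]
  calc ∑ j ∈ Finset.range i, g a j ≤ ∑ j ∈ Finset.range i, (e a + size a + 2) ^ c := by
        refine Finset.sum_le_sum fun j hj => (hc (a, j)).trans (Nat.pow_le_pow_left ?_ c)
        have := Finset.mem_range.1 hj
        simp only [size_pair]
        omega
    _ ≤ _ := by
        rw [Finset.sum_const, Finset.card_range, smul_eq_mul]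
        exact Nat.mul_le_mul_right _ hi

theorem PolyTime.mul {f g : α → ℕ} (hf : PolyTime f) (hg : PolyTime g) :
    PolyTime fun a => f a * g a :=
  (hf.sum (g := fun a _ => g a) hg.weaken).of_eq fun a => by simp

/-! ### Predicates decidable in polynomial time -/

open Classical in
/-- Decidability in polynomial time. -/
def PolyDec (P : α → Prop) : Prop := PolyTime fun a => if P a then 1 else 0

theorem PolyDec.of_iff {P Q : α → Prop} (hP : PolyDec P) (h : ∀ a, P a ↔ Q a) : PolyDec Q :=
  (funext fun a => propext (h a) : P = Q) ▸ hP

theorem PolyDec.lt {f g : α → ℕ} (hf : PolyTime f) (hg : PolyTime g) :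
    PolyDec fun a => f a < g a :=
  -- Truncated subtraction from `1`, done twice, turns `g a - f a` into the indicator of its being
  -- positive.
  ((PolyTime.const 1).sub ((PolyTime.const 1).sub (hg.sub hf))).of_eq fun a => by
    split <;> omega

theorem PolyDec.not {P : α → Prop} (hP : PolyDec P) : PolyDec fun a => ¬ P a :=
  ((PolyTime.const 1).sub hP).of_eq fun a => by by_cases h : P a <;> simp [h]

theorem PolyDec.le {f g : α → ℕ} (hf : PolyTime f) (hg : PolyTime g) :
    PolyDec fun a => f a ≤ g a :=
  (PolyDec.lt hg hf).not.of_iff fun _ => not_lt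

theorem PolyDec.imp {P Q : α → Prop} (hP : PolyDec P) (hQ : PolyDec Q) :
    PolyDec fun a => P a → Q a :=
  ((PolyTime.const 1).sub (hP.sub hQ)).of_eq fun a => by
    by_cases h : P a <;> by_cases h' : Q a <;> simp [h, h']

theorem PolyDec.count {e : α → ℕ} {P : α → ℕ → Prop} [∀ a, DecidablePred (P a)] (he : PolyTime e)
    (hP : PolyDec fun a : α × ℕ => P a.1 a.2) :
    PolyTime fun a => ((Finset.range (e a)).filter (P a)).card :=
  (PolyTime.sum (g := fun a i => if P a i then 1 else 0) he
    (PolyTime.of_eq hP fun a => by congr)).of_eq fun a => by rw [Finset.card_filter]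

theorem PolyDec.exists_lt {e : α → ℕ} {P : α → ℕ → Prop} (he : PolyTime e)
    (hP : PolyDec fun a : α × ℕ => P a.1 a.2) : PolyDec fun a => ∃ i < e a, P a i := by
  classical
  exact (PolyDec.lt (.const 0) (PolyDec.count he hP)).of_iff fun a => by
    simp [Finset.card_pos, Finset.Nonempty]

theorem PolyDec.forall_lt {e : α → ℕ} {P : α → ℕ → Prop} (he : PolyTime e)
    (hP : PolyDec fun a : α × ℕ => P a.1 a.2) : PolyDec fun a => ∀ i < e a, P a i :=
  (PolyDec.exists_lt (P := fun a i => ¬ P a i) he hP.not).not.of_iff fun a => by simp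

/-! ### Arithmetic -/

theorem PolyTime.min {f g : α → ℕ} (hf : PolyTime f) (hg : PolyTime g) :
    PolyTime fun a => min (f a) (g a) :=
  (hf.sub (hf.sub hg)).of_eq fun a => by omega

/-- The quotient counts the positive multiples of `g a` up to `f a`. -/
theorem PolyTime.div {f g : α → ℕ} (hf : PolyTime f) (hg : PolyTime g) (h : ∀ a, 0 < g a) :
    PolyTime fun a => f a / g a := by
  classical
  refine (PolyDec.count (P := fun a i => (i + 1) * g a ≤ f a) hf (PolyDec.le
    ((PolyTime.snd.add (.const 1)).mul hg.weaken) hf.weaken)).of_eq fun a => ?_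
  have : (Finset.range (f a)).filter (fun i => (i + 1) * g a ≤ f a) = Finset.range (f a / g a) := by
    ext i
    rw [Finset.mem_filter, Finset.mem_range, Finset.mem_range, Nat.lt_iff_add_one_le (m := i) (n := f a / g a),
      Nat.le_div_iff_mul_le (h a)]
    exact ⟨And.right, fun hi => ⟨(Nat.le_mul_of_pos_right _ (h a)).trans hi, hi⟩⟩
  rw [← Finset.card_range (f a / g a), ← this]

theorem PolyTime.mod {f g : α → ℕ} (hf : PolyTime f) (hg : PolyTime g) (h : ∀ a, 0 < g a) :
    PolyTime fun a => f a % g a :=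
  (hf.sub (hg.mul (hf.div hg h))).of_eq fun a => by
    have := Nat.div_add_mod (f a) (g a)
    omega

theorem PolyTime.pow_const {f : α → ℕ} (hf : PolyTime f) (c : ℕ) : PolyTime fun a => f a ^ c := by
  induction c with
  | zero => simpa using PolyTime.const 1
  | succ c ih => exact (ih.mul hf).of_eq fun a => (pow_succ _ _).symm

/-- Powers, cut off at a positive bound. -/
theorem PolyTime.min_pow {b f g : α → ℕ} (hb : PolyTime b) (hf : PolyTime f) (hg : PolyTime g)
    (h : ∀ a, 0 < b a) : PolyTime fun a => Min.min (b a) (f a ^ g a) := by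
  have hrec : ∀ a i, (Nat.rec 1 (fun _ x => Min.min (b a) (f a * x)) i : ℕ) =
      Min.min (b a) (f a ^ i) := by
    intro a i
    induction i with
    | zero => exact (min_eq_right (h a)).symm
    | succ i ih =>
      simp only [ih, pow_succ']
      -- Multiplying by a positive base never brings a value that reached the cutoff back below it;
      -- the base `0` is separate.
      rcases Nat.eq_zero_or_pos (f a) with h0 | h0
      · simp [h0]
      · rcases le_total (b a) (f a ^ i) with h1 | h1
        · have h2 : b a ≤ f a * b a := Nat.le_mul_of_pos_left _ h0
          rw [min_eq_left h1, min_eq_left h2, min_eq_left (h2.trans (Nat.mul_le_mul_left _ h1))]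
        · rw [min_eq_right h1]
  exact (PolyTime.iterate (g := fun a _ x => Min.min (b a) (f a * x)) hg (.const 1)
    (PolyTime.min hb.weaken.weaken (hf.weaken.weaken.mul .snd)) hb.1
    fun a i _ => (hrec a i).trans_le (min_le_left _ _)).of_eq fun a => hrec a (g a)

/-- A polynomial-time computable function of the input is the output of a polynomial-time program. -/
theorem PolyTime.exists_prog {f : Inst → ℕ} (hf : PolyTime f) :
    ∃ (p : Prog) (T : Polynomial ℕ), ∀ (n : ℕ) (G : SimpleGraph (Fin n)),
      ∃ t s, Exec p (initState G) t s ∧ t ≤ T.eval n ∧ s.output = f ⟨n, G⟩ := by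
  -- Register `0` holds `n`, so the result is computed in register `1` and copied at the end.
  obtain ⟨p, c, hp⟩ := hf.2 1 [0] (by simp)
  refine ⟨.seq p (.assign 0 (.var 1)), (Polynomial.X + 2) ^ c + 2, fun n G => ?_⟩
  obtain ⟨t, s, h1, h2, -, -, h5⟩ := hp (initState G) ⟨n, G⟩ ⟨rfl, by simp [initState, Ctx.vars]⟩
  refine ⟨_, _, .seq h1 (.assign _ _ _), ?_, ?_⟩
  · have : size (⟨n, G⟩ : Inst) = n := by simp [size, Ctx.vars]
    rw [this] at h2
    simpa [Expr.cost] using h2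
  · simpa [State.output, setVar_var, Expr.eval] using h5

end RAM

/-! ### Counting and digits -/

/-- A downward closed set is an initial segment, so counting it finds its threshold. This serves
both `blockSize` and `blockCoverNumber`. -/
theorem lt_card_filter_range_iff {P : ℕ → Prop} [DecidablePred P]
    (hP : ∀ i j, i ≤ j → P j → P i) {m i : ℕ} :
    i < ((Finset.range m).filter P).card ↔ i < m ∧ P i := by
  constructor
  · intro h
    by_contra hi
    refine h.not_ge ((Finset.card_le_card fun j hj => ?_).trans (Finset.card_range i).le)
    rw [Finset.mem_filter, Finset.mem_range] at hj
    rw [Finset.mem_range]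
    by_contra hij
    exact hi ⟨by omega, hP i j (by omega) hj.2⟩
  · rintro ⟨hi, hPi⟩
    refine Nat.lt_of_lt_of_le (Nat.lt_succ_self i) ((Finset.card_range (i + 1)).ge.trans
      (Finset.card_le_card fun j hj => ?_))
    rw [Finset.mem_range] at hj
    exact Finset.mem_filter.2 ⟨Finset.mem_range.2 (by omega), hP j i (by omega) hPi⟩

/-- The digit of `x` to the base `k` at the position `i`. -/
def digit (k x i : ℕ) : ℕ := x / k ^ i % k

theorem exists_digit_eq {k N : ℕ} {f : ℕ → ℕ} (hf : ∀ i < N, f i < k) :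
    ∃ x < k ^ N, ∀ i < N, digit k x i = f i := by
  let x := finFunctionFinEquiv (m := k) (n := N) fun i => ⟨f i, hf i i.2⟩
  refine ⟨x, x.2, fun i hi => ?_⟩
  have := finFunctionFinEquiv_symm_apply_val x ⟨i, hi⟩
  simp only [x, Equiv.symm_apply_apply] at this
  exact this.symm

/-! ### The size of the blocks -/

/-- The number of vertices of a block. -/
def blockSize (n : ℕ) : ℕ := ((Finset.range n).filter fun i => i ^ (i * i) < n).card + 4

theorem lt_blockSize_sub_iff {n i : ℕ} : i < blockSize n - 4 ↔ i < n ∧ i ^ (i * i) < n := by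
  refine lt_card_filter_range_iff fun i j hij hj => lt_of_le_of_lt ?_ hj
  rcases Nat.eq_zero_or_pos j with rfl | hj0
  · simp [Nat.le_zero.1 hij]
  · exact (Nat.pow_le_pow_left hij _).trans (Nat.pow_le_pow_right hj0 (Nat.mul_le_mul hij hij))

theorem blockSize_pow_le (n : ℕ) : blockSize n ^ (blockSize n * blockSize n) ≤ (n + 2) ^ 108 := by
  have h4 : 4 ≤ blockSize n := Nat.le_add_left _ _
  by_cases h : blockSize n ≤ 6
  · calc blockSize n ^ (blockSize n * blockSize n) ≤ 6 ^ (6 * 6) :=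
          (Nat.pow_le_pow_left h _).trans (Nat.pow_le_pow_right (by omega) (Nat.mul_le_mul h h))
      -- `2 ^ 108 = 8 ^ 36`.
      _ ≤ 2 ^ 108 := by norm_num
      _ ≤ _ := Nat.pow_le_pow_left (by omega) _
  -- This `i` is the largest number counted by `blockSize`. From `2 ≤ i` come `i + 5 ≤ i ^ 3` and
  -- `(i + 5) ^ 2 ≤ 13 * i ^ 2`, whence the exponent `39 = 3 * 13`.
  · obtain ⟨i, hi⟩ : ∃ i, blockSize n = i + 5 := ⟨blockSize n - 5, by omega⟩
    have h2 : 2 ≤ i := by omega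
    have hlt := (lt_blockSize_sub_iff (n := n) (i := i)).1 (by omega)
    rw [hi]
    have hb : i + 5 ≤ i ^ 3 := by nlinarith [Nat.mul_le_mul h2 h2, pow_succ i 2, pow_two i]
    have he : (i + 5) * (i + 5) ≤ 13 * (i * i) := by nlinarith
    calc (i + 5) ^ ((i + 5) * (i + 5)) ≤ (i ^ 3) ^ (13 * (i * i)) :=
          (Nat.pow_le_pow_left hb _).trans (Nat.pow_le_pow_right (by positivity) he)
      _ = (i ^ (i * i)) ^ 39 := by rw [← pow_mul, ← pow_mul]; congr 1; ring
      _ ≤ (n + 2) ^ 39 := Nat.pow_le_pow_left (by omega) _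
      _ ≤ (n + 2) ^ 108 := Nat.pow_le_pow_right (by omega) (by omega)

/-- With `k = blockSize n - 4`, maximality gives `log n ≤ k² log k`, which suffices if `log k ≤ log
log n`. Otherwise `log n ≤ k ≤ (k + 4)² / 16`, and `log log n ≥ 1 / 16`; this is what the summand
`4` in `blockSize` is for. -/
theorem log_le_blockSize_sq_mul {n : ℕ} (hn : 3 ≤ n) :
    Real.log n ≤ (blockSize n : ℝ) ^ 2 * Real.log (Real.log n) := by
  -- `log 3 = 1 + log (3 / e) ≥ 2 - e / 3 > 16 / 15`.
  have h3 : (16 : ℝ) / 15 ≤ Real.log n := by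
    have he := Real.exp_one_lt_d9
    have h1 : Real.log 3 ≤ Real.log n := Real.log_le_log (by norm_num) (by exact_mod_cast hn)
    have h2 : 1 - (3 / Real.exp 1)⁻¹ ≤ Real.log (3 / Real.exp 1) :=
      Real.one_sub_inv_le_log_of_pos (by positivity)
    rw [Real.log_div (by norm_num) (Real.exp_pos 1).ne', Real.log_exp, inv_div] at h2
    linarith
  set L := Real.log n with hL
  have hℓ : (1 : ℝ) / 16 ≤ Real.log L := by
    have h1 := Real.one_sub_inv_le_log_of_pos (x := L) (by linarith)
    have h2 : L⁻¹ ≤ (16 / 15 : ℝ)⁻¹ := inv_anti₀ (by norm_num) h3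
    norm_num at h2 ⊢
    linarith
  obtain ⟨k, hk⟩ : ∃ k, blockSize n = k + 4 := ⟨_, rfl⟩
  have hnk : n ≤ k ^ (k * k) := by
    have h := (lt_blockSize_sub_iff (n := n) (i := k)).not.1 (by omega)
    have h1 := (lt_blockSize_sub_iff (n := n) (i := 1)).2 ⟨by omega, by simpa using by omega⟩
    by_contra hlt
    push Not at h hlt
    by_cases hkn : k < n
    · exact absurd (h hkn) (by omega)
    · have hk1 : 0 < k := by omega
      have := Nat.le_self_pow (Nat.mul_pos hk1 hk1).ne' k
      omega
  have hk0 : 0 < k := by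
    rcases Nat.eq_zero_or_pos k with rfl | h
    · simp at hnk
      omega
    · exact h
  have hlog : L ≤ (k : ℝ) * k * Real.log k := by
    have h1 : Real.log n ≤ Real.log ((k : ℝ) ^ (k * k)) :=
      Real.log_le_log (by exact_mod_cast (by omega : 0 < n)) (by exact_mod_cast hnk)
    rw [Real.log_pow] at h1
    exact_mod_cast h1
  have hk0' : (0 : ℝ) < k := by exact_mod_cast hk0
  rw [hk]
  push_cast
  rcases le_total (Real.log k) (Real.log L) with h | h
  · nlinarith [mul_le_mul_of_nonneg_left h (mul_pos hk0' hk0').le]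
  · have h1 : L ≤ k := (Real.log_le_log_iff (by linarith) hk0').1 h
    nlinarith [sq_nonneg ((k : ℝ) - 4), mul_le_mul_of_nonneg_left hℓ (sq_nonneg ((k : ℝ) + 4))]

theorem lt_ceil_of_mul_blockSize_lt {n q : ℕ} (hn : 3 ≤ n) (h : q * blockSize n < n) :
    q < ⌈(n : ℝ) * √(Real.log (Real.log n)) / √(Real.log n)⌉₊ := by
  have hL : 0 < Real.log n := Real.log_pos (by exact_mod_cast (by omega : 1 < n))
  have hs := Real.sqrt_le_sqrt (log_le_blockSize_sq_mul hn)
  rw [Real.sqrt_mul (by positivity), Real.sqrt_sq (by positivity)] at hs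
  rw [Nat.lt_ceil, lt_div_iff₀ (Real.sqrt_pos.2 hL)]
  have hq : (q : ℝ) * blockSize n < n := by exact_mod_cast h
  have hpos : 0 < √(Real.log (Real.log n)) := by
    by_contra h0
    have := Real.sqrt_pos.2 hL
    nlinarith [(by positivity : (0 : ℝ) ≤ blockSize n)]
  calc (q : ℝ) * √(Real.log n) ≤ q * (blockSize n * √(Real.log (Real.log n))) := by gcongr
    _ = q * blockSize n * √(Real.log (Real.log n)) := by ring
    _ < _ := by gcongr

/-! ### Chain graphs -/

namespace SimpleGraph

variable {V : Type*} {G H : SimpleGraph V}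

/-- In a chain graph, the neighbourhoods of the vertices of a colour class are nested. -/
theorem IsChainGraph.adj_or_adj (hH : H.IsChainGraph) {c : V → Fin 2}
    (hc : ∀ u v, H.Adj u v → c u ≠ c v) {u u' v v' : V} (huu : c u = c u') (h : H.Adj u v)
    (h' : H.Adj u' v') : H.Adj u' v ∨ H.Adj u v' := by
  by_contra hcon
  push Not at hcon
  obtain ⟨h1, h2⟩ := hcon
  have huv := hc _ _ h
  have huv' := hc _ _ h'
  have hvv : c v = c v' := by omega
  have n1 : ¬ H.Adj u u' := fun hh => hc _ _ hh huu
  have n2 : ¬ H.Adj v v' := fun hh => hc _ _ hh hvv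
  have e1 : u ≠ u' := fun e => h1 (e ▸ h)
  have e2 : v ≠ v' := fun e => h2 (e ▸ h)
  have e3 : u ≠ v' := fun e => by subst e; omega
  have e4 : u' ≠ v := fun e => by subst e; omega
  -- If both cross edges are missing, the four vertices induce a matching of size `2`, since the
  -- other two pairs are monochromatic.
  refine hH.2 ⟨(⊤ : H.Subgraph).induce {u, v, u', v'}, ?_, ?_, ?_⟩
  · intro a ha b hb hab
    exact ⟨ha, hb, hab⟩
  · intro a ha
    simp only [Subgraph.induce_verts, Set.mem_insert_iff, Set.mem_singleton_iff] at ha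
    simp only [Subgraph.induce_adj, Subgraph.top_adj, Set.mem_insert_iff, Set.mem_singleton_iff]
    rcases ha with rfl | rfl | rfl | rfl
    · exact ⟨v, by simp [h], by rintro b ⟨-, rfl | rfl | rfl | rfl, hb⟩ <;> simp_all⟩
    · exact ⟨u, by simp [h.symm], by
        rintro b ⟨-, rfl | rfl | rfl | rfl, hb⟩ <;> simp_all [H.adj_comm]⟩
    · exact ⟨v', by simp [h'], by
        rintro b ⟨-, rfl | rfl | rfl | rfl, hb⟩ <;> simp_all [H.adj_comm]⟩
    · exact ⟨u', by simp [h'.symm], by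
        rintro b ⟨-, rfl | rfl | rfl | rfl, hb⟩ <;> simp_all [H.adj_comm]⟩
  · have : ((⊤ : H.Subgraph).induce {u, v, u', v'}).edgeSet = {s(u, v), s(u', v')} := by
      ext e
      induction e with
      | _ a b =>
        simp only [Subgraph.mem_edgeSet, Subgraph.induce_adj, Subgraph.top_adj,
          Set.mem_insert_iff, Set.mem_singleton_iff, Sym2.eq_iff]
        constructor
        · rintro ⟨rfl | rfl | rfl | rfl, rfl | rfl | rfl | rfl, hb⟩ <;> simp_all [H.adj_comm]
        · rintro ((⟨rfl, rfl⟩ | ⟨rfl, rfl⟩) | (⟨rfl, rfl⟩ | ⟨rfl, rfl⟩)) <;>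
            simp [h, h', h.symm, h'.symm]
    rw [this, Set.ncard_pair]
    simp [e1, e3]

/-- The graph whose edges are the pairs related by `E` in one of the two orders. -/
def orient (E : V → V → Prop) (hE : ∀ v, ¬ E v v) : SimpleGraph V where
  Adj u v := E u v ∨ E v u
  symm := ⟨fun _ _ h => h.symm⟩
  loopless := ⟨fun v h => h.elim (hE v) (hE v)⟩

/-- A bipartite graph is a chain graph if its edges can be oriented such that the
out-neighbourhoods are nested. -/
theorem isChainGraph_orient {E : V → V → Prop} {hE : ∀ v, ¬ E v v}
    (hb : (orient E hE).IsBipartite)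
    (h : ∀ u v u' v', E u v → E u' v' → E u' v ∨ E u v') : (orient E hE).IsChainGraph := by
  refine ⟨hb, ?_⟩
  rintro ⟨M, hind, hmat, hcard⟩
  obtain ⟨e, e', hne, heq⟩ := Set.ncard_eq_two.1 hcard
  have key : ∀ e ∈ M.edgeSet, ∃ u v, e = s(u, v) ∧ M.Adj u v ∧ E u v := by
    intro e he
    induction e with
    | _ a b =>
      rw [Subgraph.mem_edgeSet] at he
      rcases he.adj_sub with hab | hab
      · exact ⟨a, b, rfl, he, hab⟩
      · exact ⟨b, a, Sym2.eq_swap, he.symm, hab⟩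
  have uniq : ∀ {x y z}, M.Adj x y → M.Adj x z → y = z := fun hxy hxz =>
    (hmat hxy.fst_mem).unique hxy hxz
  -- A cross edge would lie in `M`, which is induced, and a matching then forces the two edges to
  -- coincide.
  have main : ∀ {u v u' v'}, M.Adj u v → M.Adj u' v' → E u' v → u = u' ∧ v = v' := by
    intro u v u' v' h1 h2 h3
    have h4 : M.Adj u' v := hind h2.fst_mem h1.snd_mem (Or.inl h3)
    exact ⟨uniq h1.symm h4.symm, uniq h4 h2⟩
  obtain ⟨u, v, rfl, h1, h2⟩ := key e (heq ▸ Set.mem_insert _ _)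
  obtain ⟨u', v', rfl, h1', h2'⟩ := key e' (heq ▸ Set.mem_insert_of_mem _ rfl)
  rcases h u v u' v' h2 h2' with h3 | h3
  · obtain ⟨rfl, rfl⟩ := main h1 h1' h3
    exact hne rfl
  · obtain ⟨rfl, rfl⟩ := main h1' h1 h3
    exact hne rfl

theorem IsBipartite.of_le (hG : G.IsBipartite) (h : H ≤ G) : H.IsBipartite :=
  Colorable.mono_left h hG

/-- Covers indexed by an arbitrary finite type. -/
theorem exists_isChainCover {ι : Type*} [Fintype ι] {C : ι → SimpleGraph V}
    (h : ∀ i, (C i).IsChainGraph) (hC : ∀ u v, G.Adj u v ↔ ∃ i, (C i).Adj u v) :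
    ∃ D : Fin (Fintype.card ι) → SimpleGraph V, G.IsChainCover D := by
  refine ⟨fun i => C ((Fintype.equivFin ι).symm i), fun i => h _, ?_⟩
  ext e
  induction e with
  | _ a b =>
    simp only [Set.mem_iUnion, mem_edgeSet, hC]
    exact (Fintype.equivFin ι).symm.surjective.exists (p := fun i => (C i).Adj a b) |>.symm

end SimpleGraph

/-! ### Chain covers of the edges that meet a block -/

section Blocks

variable {n : ℕ} (G : SimpleGraph (Fin n))

/-- Adjacency of natural numbers, as vertices of `G`. -/
def AdjNat (u v : ℕ) : Prop := ∃ (hu : u < n) (hv : v < n), G.Adj ⟨u, hu⟩ ⟨v, hv⟩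

/-- The digits of `x` encode `c` rankings of the vertices of the block `q`, such that every edge
`uv` with `u` in the block has a ranking for which every vertex of the block that is not above `u`
is adjacent to `v`. -/
def IsBlockCover (k q c x : ℕ) : Prop :=
  ∀ a < k, ∀ b < n, AdjNat G (q * k + a) b → ∃ j < c, ∀ a' < k, q * k + a' < n →
    digit k x (j * k + a') ≤ digit k x (j * k + a) → AdjNat G (q * k + a') b

/-- The block `q` has a cover by `c` rankings. -/
def Coverable (k q c : ℕ) : Prop := ∃ x < k ^ (k * k), IsBlockCover G k q c x

open Classical in
/-- The smallest number of rankings that cover the block `q`. -/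
noncomputable def blockCoverNumber (k q : ℕ) : ℕ :=
  ((Finset.range k).filter fun c => ¬ Coverable G k q c).card

/-- The number that the algorithm computes. -/
noncomputable def chainCoverEstimate : ℕ :=
  ∑ q ∈ Finset.range n, blockCoverNumber G (blockSize n) q

/-! ### Rankings of a single block -/

variable {G} {k q c : ℕ}

theorem Coverable.mono {c' : ℕ} (h : Coverable G k q c) (hc : c ≤ c') : Coverable G k q c' := by
  obtain ⟨x, hx, h⟩ := h
  refine ⟨x, hx, fun a ha b hb hab => ?_⟩
  obtain ⟨j, hj, hj'⟩ := h a ha b hb hab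
  exact ⟨j, hj.trans_le hc, hj'⟩

/-- The rank of `a` in the ranking `j` becomes the digit at `j * k + a`; `c ≤ k` keeps these
positions below `k * k`. -/
theorem coverable_of_rankings (hc : c ≤ k) (F : ℕ → ℕ → ℕ) (hF : ∀ j, ∀ a < k, F j a < k)
    (h : ∀ a < k, ∀ b < n, AdjNat G (q * k + a) b → ∃ j < c, ∀ a' < k, q * k + a' < n →
      F j a' ≤ F j a → AdjNat G (q * k + a') b) : Coverable G k q c := by
  obtain ⟨x, hx, hx'⟩ := exists_digit_eq (k := k) (N := k * k) (f := fun i => F (i / k) (i % k))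
    fun i hi => hF _ _ (Nat.mod_lt _ (by rcases Nat.eq_zero_or_pos k with rfl | h <;> omega))
  have key : ∀ j < c, ∀ a < k, digit k x (j * k + a) = F j a := by
    intro j hj a ha
    rw [hx' _ (by nlinarith), mul_comm, Nat.mul_add_div (by omega), Nat.div_eq_of_lt ha,
      Nat.mul_add_mod, Nat.mod_eq_of_lt ha, add_zero]
  refine ⟨x, hx, fun a ha b hb hab => ?_⟩
  obtain ⟨j, hj, hj'⟩ := h a ha b hb hab
  refine ⟨j, hj, fun a' ha' hn hle => hj' a' ha' hn ?_⟩
  rwa [key j hj a' ha', key j hj a ha] at hle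

/-- One ranking per vertex: `j` alone gets rank `0` and so covers all its edges. The ranks `0` and
`1` are digits because `2 ≤ k`. -/
theorem coverable_self (hk : 2 ≤ k) : Coverable G k q k := by
  refine coverable_of_rankings le_rfl (fun j a => if a = j then 0 else 1)
    (fun j a _ => by split <;> omega) fun a ha b _ hab => ⟨a, ha, fun a' _ _ hle => ?_⟩
  by_cases h : a' = a
  · exact h ▸ hab
  · simp [h] at hle

theorem lt_blockCoverNumber_iff : c < blockCoverNumber G k q ↔ c < k ∧ ¬ Coverable G k q c := by
  classical
  exact lt_card_filter_range_iff fun i j hij hj hi => hj (hi.mono hij)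

theorem coverable_blockCoverNumber (hk : 2 ≤ k) : Coverable G k q (blockCoverNumber G k q) := by
  by_contra h
  refine lt_irrefl (blockCoverNumber G k q) (lt_blockCoverNumber_iff.2 ⟨?_, h⟩)
  by_contra hlt
  exact h ((coverable_self hk).mono (by omega))

theorem Coverable.blockCoverNumber_le (h : Coverable G k q c) : blockCoverNumber G k q ≤ c := by
  by_contra hlt
  exact (lt_blockCoverNumber_iff.1 (not_le.1 hlt)).2 h

theorem blockCoverNumber_le_self : blockCoverNumber G k q ≤ k := by
  by_contra hlt
  exact lt_irrefl k (lt_blockCoverNumber_iff.1 (not_le.1 hlt)).1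

theorem blockCoverNumber_eq_zero (h : n ≤ q * k) : blockCoverNumber G k q = 0 := by
  rcases Nat.eq_zero_or_pos k with rfl | hk
  · exact Nat.le_zero.1 blockCoverNumber_le_self
  · exact Nat.le_zero.1 (Coverable.blockCoverNumber_le ⟨0, by positivity,
      fun a _ b _ ⟨hu, _⟩ => absurd hu (by omega)⟩)

/-- Covers of the blocks by rankings give a cover of the graph by chain graphs. -/
theorem exists_isChainCover_sum (hG : G.IsBipartite) (hk : 2 ≤ k) :
    ∃ C : Fin (∑ q ∈ Finset.range n, blockCoverNumber G k q) → SimpleGraph (Fin n),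
      G.IsChainCover C := by
  have hcov : ∀ q, ∃ x, IsBlockCover G k q (blockCoverNumber G k q) x := fun q =>
    (coverable_blockCoverNumber hk).imp fun _ h => h.2
  choose x hx using hcov
  let E : (Σ q : Fin n, Fin (blockCoverNumber G k q)) → Fin n → Fin n → Prop := fun i u v =>
    (u : ℕ) / k = i.1 ∧ G.Adj u v ∧ ∀ u' : Fin n, (u' : ℕ) / k = i.1 →
      digit k (x i.1) (i.2 * k + u' % k) ≤ digit k (x i.1) (i.2 * k + u % k) → G.Adj u' v
  have hE : ∀ i v, ¬ E i v v := fun i v h => h.2.1.ne rfl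
  have hle : ∀ i u v, (SimpleGraph.orient (E i) (hE i)).Adj u v → G.Adj u v := fun i u v h =>
    h.elim (fun h => h.2.1) fun h => h.2.1.symm
  have := SimpleGraph.exists_isChainCover (G := G) (C := fun i => SimpleGraph.orient (E i) (hE i))
    (fun i => SimpleGraph.isChainGraph_orient (hG.of_le fun u v h => hle i u v h)
      fun u v u' v' h h' => ?_) fun u v => ⟨fun h => ?_, fun ⟨i, h⟩ => hle i u v h⟩
  · rwa [Fintype.card_sigma, Finset.sum_congr rfl fun _ _ => Fintype.card_fin _,
      Fin.sum_univ_eq_sum_range (fun q => blockCoverNumber G k q) n] at this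
  -- Of two block vertices, the one of smaller rank has the larger out-neighbourhood.
  · rcases le_total (digit k (x i.1) (i.2 * k + u' % k)) (digit k (x i.1) (i.2 * k + u % k))
      with hd | hd
    · exact Or.inl ⟨h'.1, h.2.2 u' h'.1 hd, fun w hw hwd => h.2.2 w hw (hwd.trans hd)⟩
    · exact Or.inr ⟨h.1, h'.2.2 u h.1 hd, fun w hw hwd => h'.2.2 w hw (hwd.trans hd)⟩
  · have hdiv : ∀ w : ℕ, w / k * k + w % k = w := fun w => by
      rw [mul_comm]; exact Nat.div_add_mod w k
    obtain ⟨j, hj, hj'⟩ := hx (u / k) (u % k) (Nat.mod_lt _ (by omega)) v v.2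
      (by rw [hdiv]; exact ⟨u.2, v.2, h⟩)
    refine ⟨⟨⟨u / k, (Nat.div_le_self _ _).trans_lt u.2⟩, ⟨j, hj⟩⟩, Or.inl ⟨rfl, h, ?_⟩⟩
    intro u' hu' hd
    have hu'' : (u : ℕ) / k * k + u' % k = u' := by rw [← hdiv u', hu']; simp
    obtain ⟨_, _, hadj⟩ := hj' (u' % k) (Nat.mod_lt _ (by omega)) (by rw [hu'']; exact u'.2) hd
    simpa only [hu''] using hadj

/-! ### From chain covers to rankings -/

/-- The number of predecessors of `a` below `k`. -/
noncomputable def predCount (k : ℕ) (r : ℕ → ℕ → Prop) (a : ℕ) : ℕ :=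
  open Classical in ((Finset.range k).filter fun b => r b a).card

theorem predCount_lt {r : ℕ → ℕ → Prop} (hr : ∀ a, ¬ r a a) {a : ℕ} (ha : a < k) :
    predCount k r a < k := by
  classical
  refine (Finset.card_lt_card (Finset.ssubset_iff_subset_ne.2 ⟨Finset.filter_subset _ _,
    fun h => ?_⟩)).trans_eq (Finset.card_range k)
  have := h ▸ Finset.mem_range.2 ha
  exact hr a (Finset.mem_filter.1 this).2

/-- By transitivity the predecessors of `a` are predecessors of `b`, and `a` itself is a further
one. So `predCount` extends a strict partial order to a ranking. -/
theorem predCount_lt_predCount {r : ℕ → ℕ → Prop} (hr : ∀ a, ¬ r a a)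
    (htr : ∀ a b c, r a b → r b c → r a c) {a b : ℕ} (ha : a < k) (hab : r a b) :
    predCount k r a < predCount k r b := by
  classical
  refine Finset.card_lt_card ((Finset.ssubset_iff_of_subset fun x hx => ?_).2 ⟨a, ?_, ?_⟩)
  · rw [Finset.mem_filter] at hx ⊢
    exact ⟨hx.1, htr _ _ _ hx.2 hab⟩
  · exact Finset.mem_filter.2 ⟨Finset.mem_range.2 ha, hab⟩
  · exact fun h => hr a (Finset.mem_filter.1 h).2

/-- Every chain graph of a cover gives two rankings of a block, one for each colour class. -/
theorem coverable_two_mul (hG : G.IsBipartite) {h : ℕ} {C : Fin h → SimpleGraph (Fin n)}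
    (hC : G.IsChainCover C) (hk : 2 * h ≤ k) : Coverable G k q (2 * h) := by
  obtain ⟨col⟩ := hG
  have hmem : ∀ u v, G.Adj u v ↔ ∃ i, (C i).Adj u v := fun u v => by
    rw [← SimpleGraph.mem_edgeSet, ← hC.2, Set.mem_iUnion]
    rfl
  -- The index `j` encodes the chain graph `j / 2` and the colour `j % 2`. Vertices of that colour
  -- precede all others, and among them larger neighbourhoods come first.
  let r : ℕ → ℕ → ℕ → Prop := fun j a' a => ∃ (hj : j / 2 < h) (ha' : q * k + a' < n)
    (ha : q * k + a < n), (col ⟨_, ha'⟩ : ℕ) = j % 2 ∧ ((col ⟨_, ha⟩ : ℕ) = j % 2 →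
      (C ⟨_, hj⟩).neighborSet ⟨_, ha⟩ ⊂ (C ⟨_, hj⟩).neighborSet ⟨_, ha'⟩)
  have hr : ∀ j a, ¬ r j a a := fun j a ⟨_, _, _, h1, h2⟩ => (h2 h1).ne rfl
  have htr : ∀ j a b c, r j a b → r j b c → r j a c := by
    rintro j a b c ⟨hj, ha, hb, h1, h2⟩ ⟨_, _, hc, h3, h4⟩
    exact ⟨hj, ha, hc, h1, fun h5 => (h4 h5).trans (h2 h3)⟩
  refine coverable_of_rankings hk (fun j => predCount k (r j)) (fun j a ha => predCount_lt (hr j) ha)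
    ?_
  rintro a ha b - ⟨hu, hb, hadj⟩
  obtain ⟨i, hi⟩ := (hmem _ _).1 hadj
  set u : Fin n := ⟨q * k + a, hu⟩ with hu_def
  have hcol : (col u : ℕ) < 2 := (col u).2
  have hdiv : (2 * (i : ℕ) + col u) / 2 = i := by omega
  have hmod : (2 * (i : ℕ) + col u) % 2 = col u := by omega
  refine ⟨2 * i + col u, by omega, fun a' ha' hu' hle => ⟨hu', hb, ?_⟩⟩
  have hnot : ¬ r (2 * i + col u) a a' := fun hra =>
    absurd (predCount_lt_predCount (hr _) (htr _) ha hra) (not_lt.2 hle)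
  have hi' : (⟨_, hdiv.symm ▸ i.2⟩ : Fin h) = i := Fin.ext hdiv
  refine (hmem _ _).2 ⟨i, ?_⟩
  by_contra hno
  -- If `b` is a neighbour of `a` but not of `a'`, then `a` precedes `a'`: by colour if the colours
  -- differ, otherwise because nestedness makes the neighbourhood of `a'` strictly smaller.
  refine hnot ⟨hdiv.symm ▸ i.2, hu, hu', hmod.symm, fun hsame => ?_⟩
  rw [hi', Set.ssubset_iff_of_subset]
  · exact ⟨_, hi, hno⟩
  · intro w hw
    exact ((hC.1 i).adj_or_adj (fun u v huv => col.valid ((hmem u v).2 ⟨i, huv⟩))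
      (Fin.ext (hmod.symm.trans hsame.symm)) hi hw).resolve_left hno

theorem chainCoverNumber_le_chainCoverEstimate (hG : G.IsBipartite) :
    G.chainCoverNumber ≤ chainCoverEstimate G :=
  Nat.sInf_le (exists_isChainCover_sum hG (Nat.le_add_left _ _))

theorem blockCoverNumber_le (hG : G.IsBipartite) :
    blockCoverNumber G k q ≤ 2 * G.chainCoverNumber := by
  rcases le_total (2 * G.chainCoverNumber) k with h | h
  · obtain ⟨C, hC⟩ := Nat.sInf_mem (s := {k | ∃ C : Fin k → SimpleGraph (Fin n), G.IsChainCover C})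
      ⟨_, exists_isChainCover_sum hG le_rfl⟩
    exact (coverable_two_mul hG hC h).blockCoverNumber_le
  -- When `2 ch(G)` exceeds `k`, the rankings need not fit into `k * k` digits, but the trivial
  -- bound `k` suffices.
  · exact blockCoverNumber_le_self.trans h

theorem chainCoverEstimate_le (hG : G.IsBipartite) (hn : 3 ≤ n) :
    chainCoverEstimate G ≤ chainCoverFactor n * G.chainCoverNumber := by
  set M := ⌈(n : ℝ) * √(Real.log (Real.log n)) / √(Real.log n)⌉₊ with hM
  calc chainCoverEstimate G
      ≤ ∑ q ∈ Finset.range n, if q < M then 2 * G.chainCoverNumber else 0 := by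
        refine Finset.sum_le_sum fun q _ => ?_
        split_ifs with hq
        · exact blockCoverNumber_le hG
        · refine (blockCoverNumber_eq_zero ?_).le
          by_contra hlt
          exact hq (lt_ceil_of_mul_blockSize_lt hn (not_le.1 hlt))
    _ = ((Finset.range n).filter (· < M)).card * (2 * G.chainCoverNumber) := by
        rw [← Finset.sum_filter, Finset.sum_const, smul_eq_mul]
    _ ≤ M * (2 * G.chainCoverNumber) := by
        refine Nat.mul_le_mul_right _ ((Finset.card_le_card fun q hq => ?_).trans
          (Finset.card_range M).le)
        exact Finset.mem_range.2 (Finset.mem_filter.1 hq).2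
    _ = _ := by rw [chainCoverFactor]; ring

end Blocks

/-! ### The algorithm -/

namespace RAM

variable {α : Type} [Ctx α]

/-- Cutting the power off at `n + 1` does not affect its comparison with `n`. -/
theorem PolyTime.blockSize : PolyTime fun a : α => blockSize (Ctx.inp a).1 := by
  refine PolyTime.add (PolyDec.count .order (PolyDec.of_iff (P := fun a : α × ℕ =>
    Min.min ((Ctx.inp a.1).1 + 1) (a.2 ^ (a.2 * a.2)) < (Ctx.inp a.1).1) (.lt
      (.min_pow (PolyTime.weaken (.add .order (.const 1))) .snd (.mul .snd .snd)
        fun _ => Nat.succ_pos _) (PolyTime.weaken .order)) fun a => ?_)) (.const 4)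
  omega

theorem PolyTime.blockSize_pow : PolyTime fun a : α =>
    _root_.blockSize (Ctx.inp a).1 ^
      (_root_.blockSize (Ctx.inp a).1 * _root_.blockSize (Ctx.inp a).1) :=
  (PolyTime.min_pow (b := fun a : α => ((Ctx.inp a).1 + 2) ^ 108) ((PolyTime.order.add
    (.const 2)).pow_const 108) .blockSize (.mul .blockSize .blockSize)
    fun _ => by positivity).of_eq fun _ => min_eq_right (blockSize_pow_le _)

/-- The divisor `k ^ i` may be huge, but once it exceeds the dividend the quotient is `0`, so it can
be cut off just above the dividend. -/
theorem PolyTime.digit {k f g : α → ℕ} (hk : PolyTime k) (hf : PolyTime f) (hg : PolyTime g)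
    (h : ∀ a, 0 < k a) : PolyTime fun a => digit (k a) (f a) (g a) := by
  have hb := PolyTime.min_pow (hf.add (.const 1)) hk hg fun _ => Nat.succ_pos _
  refine ((hf.div hb fun a => ?_).mod hk h).of_eq fun a => ?_
  · exact lt_min (Nat.succ_pos _) (Nat.pow_pos (h a))
  · rw [_root_.digit]
    rcases le_total (f a + 1) (k a ^ g a) with hle | hle
    · rw [min_eq_left hle, Nat.div_eq_of_lt (Nat.lt_succ_self _), Nat.div_eq_of_lt hle]
    · rw [min_eq_right hle]

theorem initState_arr_pos_iff {n : ℕ} {G : SimpleGraph (Fin n)} {u v : ℕ} (hv : v < n) :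
    0 < (initState G).arr 0 (u * n + v) ↔ AdjNat G u v := by
  simp only [initState]
  constructor
  · intro h
    split at h
    · rename_i hex
      obtain ⟨-, i, j, hij, hadj⟩ := hex
      have h1 : u = i := by
        have := congrArg (· / n) hij
        simpa [mul_comm _ n, Nat.mul_add_div (by omega : 0 < n), Nat.div_eq_of_lt hv,
          Nat.div_eq_of_lt j.2] using this
      have h2 : v = j := by
        have := congrArg (· % n) hij
        simpa [Nat.mod_eq_of_lt hv, Nat.mod_eq_of_lt j.2] using this
      subst h1 h2
      exact ⟨i.2, hv, hadj⟩
    · omega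
  · rintro ⟨hu, _, hadj⟩
    rw [if_pos ⟨rfl, ⟨u, hu⟩, ⟨v, hv⟩, rfl, hadj⟩]
    exact one_pos

/-- The test `g a < n` is needed, as otherwise the cell could belong to another pair; for `f a` out
of range the cell is `0` anyway. -/
theorem PolyDec.adjNat {f g : α → ℕ} (hf : PolyTime f) (hg : PolyTime g) :
    PolyDec fun a => AdjNat (Ctx.inp a).2 (f a) (g a) := by
  refine PolyDec.of_iff (PolyDec.not (PolyDec.imp (PolyDec.lt hg .order) (PolyDec.not (PolyDec.lt
    (.const 0) (PolyTime.read ((hf.mul .order).add hg)))))) fun a => ?_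
  rw [Classical.not_imp, not_not]
  exact ⟨fun h => (initState_arr_pos_iff h.1).1 h.2,
    fun h => ⟨h.2.1, (initState_arr_pos_iff h.2.1).2 h⟩⟩

theorem polyTime_chainCoverEstimate : PolyTime fun a : Inst => chainCoverEstimate a.2 := by
  have hk : ∀ {β : Type} [Ctx β], PolyTime fun a : β => _root_.blockSize (Ctx.inp a).1 :=
    PolyTime.blockSize
  have hpos : ∀ n, 0 < _root_.blockSize n := fun n => Nat.succ_pos _
  have hcov : PolyDec fun a : (Inst × ℕ) × ℕ =>
      Coverable a.1.1.2 (_root_.blockSize a.1.1.1) a.1.2 a.2 := by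
    refine PolyDec.exists_lt .blockSize_pow (PolyDec.forall_lt hk (PolyDec.forall_lt .order
      (PolyDec.imp (PolyDec.adjNat ?_ .snd) (PolyDec.exists_lt ?_ (PolyDec.forall_lt hk
        (PolyDec.imp (PolyDec.lt ?_ .order) (PolyDec.imp (PolyDec.le (.digit hk ?_ ?_ ?_)
          (.digit hk ?_ ?_ ?_)) (PolyDec.adjNat ?_ ?_))))))))
    · exact (PolyTime.mul (PolyTime.weaken (.weaken (.weaken (.weaken .snd)))) hk).add
        (PolyTime.weaken .snd)
    · exact PolyTime.weaken (.weaken (.weaken .snd))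
    · exact (PolyTime.mul (PolyTime.weaken (.weaken (.weaken (.weaken (.weaken (.weaken .snd))))))
        hk).add .snd
    · exact PolyTime.weaken (.weaken (.weaken (.weaken .snd)))
    · exact (PolyTime.mul (PolyTime.weaken .snd) hk).add .snd
    · exact fun _ => hpos _
    · exact PolyTime.weaken (.weaken (.weaken (.weaken .snd)))
    · exact (PolyTime.mul (PolyTime.weaken .snd) hk).add (PolyTime.weaken (.weaken (.weaken .snd)))
    · exact fun _ => hpos _
    · exact (PolyTime.mul (PolyTime.weaken (.weaken (.weaken (.weaken (.weaken (.weaken .snd))))))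
        hk).add .snd
    · exact PolyTime.weaken (.weaken .snd)
  classical
  exact PolyTime.sum .order (PolyDec.count (α := Inst × ℕ) hk hcov.not)

end RAM

theorem mainTheorem3 :
    ∃ (p : RAM.Prog) (T : Polynomial ℕ),
      ∀ (n : ℕ) (G : SimpleGraph (Fin n)), G.IsBipartite →
        ∃ (t : ℕ) (s : RAM.State),
          RAM.Exec p (RAM.initState G) t s ∧ t ≤ T.eval n ∧
            (3 ≤ n →
              G.chainCoverNumber ≤ s.output ∧
                s.output ≤ chainCoverFactor n * G.chainCoverNumber) := by
  obtain ⟨p, T, h⟩ := RAM.polyTime_chainCoverEstimate.exists_prog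
  refine ⟨p, T, fun n G hG => ?_⟩
  obtain ⟨t, s, h1, h2, h3⟩ := h n G
  exact ⟨t, s, h1, h2, fun hn => h3 ▸
    ⟨chainCoverNumber_le_chainCoverEstimate hG, chainCoverEstimate_le hG hn⟩⟩
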